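/- Let $v=(v_1,v_2):\mathbb{R}^2\to\mathbb{R}^2$ be a continuously differentiable (in particular, a smooth) vector field with $|v_1(x)|<1$ for all $x\in\mathbb{R}^2$, let $\mathbb{D}=\{u\in\mathbb{R}^2: u_1^2+u_2^2\le 1\}$, and let $A=(a_1,a_2)$, $B=(b_1,b_2)$ be points of the strip $S=\{x\in\mathbb{R}^2:-1\le x_1\le 1\}$. Assume that the flow along the axis $x_1=0$ is in the direction from $A$ to $B$, that is, either $a_2\le b_2$ and $v_2\ge 0$ on $S$, or $b_2\le a_2$ and $v_2\le 0$ on $S$. Call $(T,x,u)$ a feasible process if $T\ge 0$, $u:[0,T]\to\mathbb{D}$ is Lebesgue measurable, $x:[0,T]\to\mathbb{R}^2$ is absolutely continuous, $\dot x(t)=u(t)+v(x(t))$ for almost every $t\in[0,T]$, $x(0)=A$, $x(T)=B$, and $-1\le x_1(t)\le 1$ for all $t\in[0,T]$. Then: 1. If $a_1=b_1$, i.e. if the direction from $A$ to $B$ is that of the axis $x_1=0$, a feasible process exists. 2. Whenever a feasible process exists (for arbitrary $A,B\in S$; in particular always when $a_1=b_1$), the time-optimal problem of minimizing $T$ over all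 feasible processes has a solution: there is a feasible process $(T^*,x^*,u^*)$ such that $T^*\le T$ for every feasible process $(T,x,u)$. -/

import Mathlib

open MeasureTheory Set

/-- The plane with its Euclidean norm; the coordinates `x₁, x₂` are `x 0, x 1`. -/
abbrev Plane : Type := EuclideanSpace ℝ (Fin 2)

/-- The waterway `-1 ≤ x₁ ≤ 1` (the state constraint set). -/
def waterway : Set Plane := {x | -1 ≤ x 0 ∧ x 0 ≤ 1}

/-- The closed unit disk `u₁² + u₂² ≤ 1`. -/
def unitDisk : Set Plane := {u | u 0 ^ 2 + u 1 ^ 2 ≤ 1}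

/-- `(T, x, u)` is a feasible process of the time-optimal problem with control set `U`, flow `v`,
starting point `A` and terminal point `B`. Only the values of `x` and `u` on `[0, T]` matter. -/
structure IsFeasibleProcess (U : Set Plane) (v : Plane → Plane) (A B : Plane)
    (T : ℝ) (x u : ℝ → Plane) : Prop where
  time_nonneg : 0 ≤ T
  /-- The control is Lebesgue measurable on `[0, T]`. -/
  control_measurable : AEMeasurable u (volume.restrict (Icc 0 T))
  control_mem : ∀ t ∈ Icc 0 T, u t ∈ U
  arc_absolutelyContinuous : AbsolutelyContinuousOnInterval x 0 T
  dynamics : ∀ᵐ t ∂(volume.restrict (Icc 0 T)), HasDerivAt x (u t + v (x t)) t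
  initial : x 0 = A
  terminal : x T = B
  state_mem : ∀ t ∈ Icc 0 T, x t ∈ waterway

/-- `(T, x, u)` is a solution of the time-optimal problem: a feasible process of minimal time. -/
def IsTimeOptimal (U : Set Plane) (v : Plane → Plane) (A B : Plane)
    (T : ℝ) (x u : ℝ → Plane) : Prop :=
  IsFeasibleProcess U v A B T x u ∧
    ∀ (T' : ℝ) (x' u' : ℝ → Plane), IsFeasibleProcess U v A B T' x' u' → T ≤ T'

/-- In the waterway, the component of the flow along the axis `x₁ = 0` never points against the
direction from `A` to `B`. -/
def FlowsFromTo (v : Plane → Plane) (A B : Plane) : Prop :=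
  (A 1 ≤ B 1 ∧ ∀ x ∈ waterway, 0 ≤ v x 1) ∨ (B 1 ≤ A 1 ∧ ∀ x ∈ waterway, v x 1 ≤ 0)

/-!
Feasibility when `A 0 = B 0`. Since `|v₁| < 1`, a control can cancel the transversal component of
the flow and keep `√(1 - v₁²) > 0` for the motion along the axis. On the line through `A` and `B`
this motion is governed by the scalar equation `φ' = ± √(1 - v₁²) + v₂`, whose right-hand side has
the sign of the direction from `A` to `B`, because `v₂` does not point against it. Such an equation
is solved by inverting the travel time `∫ 1 / |φ'|` (`exists_hasDerivAt_comp_of_pos`), and the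
target is reached in finite time.

Existence of an optimal process. The control is eliminated: a Lipschitz arc `x` from `A` to `B` in
the waterway is the arc of some feasible process exactly when `‖x t - x s - ∫ₛᵗ v(x)‖ ≤ t - s` for all `s ≤ t`
(`HasUnitDeviation`). One direction integrates the dynamics; in the other,
the arc is differentiable almost everywhere and `u = x' - v(x)` is the control, so no measurable
selection theorem is needed. This condition passes to pointwise limits of uniformly bounded arcs
(`hasUnitDeviation_of_tendsto`), which replaces the weak compactness of the controls.

Boundedness is where the direction of the flow enters, as `v` is not assumed bounded on the
waterway. The component along the axis can move against the direction from `A` to `B` at unit speed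
at most, so that in time `T` the arc neither retreats from `A` nor overshoots `B` by more than `T`
(`HasUnitDeviation.abs_apply_one_le`). Hence the arcs of a minimizing sequence stay in a compact
set and are equi-Lipschitz, and the Arzelà–Ascoli theorem, applied on `[0, τ]` with `τ` the infimum
of the times, yields the optimal arc.
-/

open Filter Topology

/-! ### Absolutely continuous arcs -/

theorem LipschitzWith.comp_absolutelyContinuousOnInterval {X Y : Type*} [PseudoMetricSpace X]
    [PseudoMetricSpace Y] {C : NNReal} {g : X → Y} (hg : LipschitzWith C g) {f : ℝ → X} {a b : ℝ}
    (hf : AbsolutelyContinuousOnInterval f a b) :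
    AbsolutelyContinuousOnInterval (g ∘ f) a b := by
  unfold AbsolutelyContinuousOnInterval at hf ⊢
  refine squeeze_zero (fun E => Finset.sum_nonneg fun i _ => dist_nonneg) (fun E => ?_)
    (by simpa using hf.const_mul (C : ℝ))
  rw [Finset.mul_sum]
  exact Finset.sum_le_sum fun i _ => hg.dist_le_mul _ _

/-- An absolutely continuous arc with velocity `u + w`, `‖u‖ ≤ 1`, deviates from the displacement
`∫ w` due to `w` alone by at most the elapsed time. -/
theorem norm_sub_sub_integral_le_of_ae_hasDerivAt {E : Type*} [NormedAddCommGroup E]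
    [InnerProductSpace ℝ E] [CompleteSpace E] {x u w : ℝ → E} {s t : ℝ} (hst : s ≤ t)
    (hx : AbsolutelyContinuousOnInterval x s t)
    (hd : ∀ᵐ r ∂volume.restrict (Icc s t), HasDerivAt x (u r + w r) r)
    (hu : ∀ r ∈ Icc s t, ‖u r‖ ≤ 1) (hw : ContinuousOn w (Icc s t)) :
    ‖x t - x s - ∫ r in s..t, w r‖ ≤ t - s := by
  have hwi : IntervalIntegrable w volume s t :=
    ContinuousOn.intervalIntegrable (by rwa [uIcc_of_le hst])
  set d := x t - x s - ∫ r in s..t, w r with hd_def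
  -- It suffices to test the deviation `d` against itself, which reduces to real-valued functions.
  suffices h : inner ℝ d d ≤ ‖d‖ * (t - s) by
    rw [real_inner_self_eq_norm_mul_norm] at h
    rcases (norm_nonneg d).eq_or_lt with h0 | h0
    · rw [← h0]; linarith
    · exact le_of_mul_le_mul_left h h0
  have hac : AbsolutelyContinuousOnInterval (fun r => inner ℝ d (x r)) s t :=
    (innerSL ℝ d).lipschitz.comp_absolutelyContinuousOnInterval hx
  have hwd : IntervalIntegrable (fun r => inner ℝ d (w r)) volume s t :=
    (innerSL ℝ d).integrable_comp hwi.1 |> fun h1 =>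
      ⟨h1, (innerSL ℝ d).integrable_comp hwi.2⟩
  have h1 := hac.integral_deriv_eq_sub
  have h2 : ∫ r in s..t, inner ℝ d (w r) = inner ℝ d (∫ r in s..t, w r) :=
    (innerSL ℝ d).intervalIntegral_comp_comm hwi
  have h3 : (inner ℝ d d : ℝ) = ∫ r in s..t, (deriv (fun r => (inner ℝ d (x r) : ℝ)) r
      - inner ℝ d (w r)) := by
    rw [intervalIntegral.integral_sub hac.intervalIntegrable_deriv hwd, h1, h2]
    rw [← inner_sub_right, ← inner_sub_right, ← hd_def]
  rw [h3]
  calc _ ≤ ∫ r in s..t, ‖d‖ := by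
        refine intervalIntegral.integral_mono_ae_restrict hst
          (hac.intervalIntegrable_deriv.sub hwd) intervalIntegrable_const ?_
        filter_upwards [hd, ae_restrict_mem measurableSet_Icc] with r hr hrm
        have : HasDerivAt (fun r => (inner ℝ d (x r) : ℝ)) (inner ℝ d (u r + w r)) r :=
          (innerSL ℝ d).hasFDerivAt.comp_hasDerivAt r hr
        rw [this.deriv, inner_add_right, add_sub_cancel_right]
        calc inner ℝ d (u r) ≤ ‖d‖ * ‖u r‖ := real_inner_le_norm _ _
          _ ≤ ‖d‖ * 1 := by gcongr; exact hu r hrm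
          _ = ‖d‖ := mul_one _
    _ = ‖d‖ * (t - s) := by simp [mul_comm]

/-! ### Arcs without controls -/

theorem mem_unitDisk_iff {u : Plane} : u ∈ unitDisk ↔ ‖u‖ ≤ 1 := by
  rw [EuclideanSpace.norm_eq, Real.sqrt_le_one, Fin.sum_univ_two]
  simp [unitDisk]

/-- On `[0, T]`, the arc `x` deviates from the displacement due to the flow `v` at no more than
unit speed. This is the dynamics of the control system in a form that makes no mention of the
control, and that passes to pointwise limits. -/
def HasUnitDeviation (v : Plane → Plane) (T : ℝ) (x : ℝ → Plane) : Prop :=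
  ∀ s t, 0 ≤ s → s ≤ t → t ≤ T → ‖x t - x s - ∫ r in s..t, v (x r)‖ ≤ t - s

section Feasible

variable {v : Plane → Plane} {A B : Plane} {T : ℝ} {x u : ℝ → Plane}

theorem IsFeasibleProcess.continuousOn {U : Set Plane} (h : IsFeasibleProcess U v A B T x u) :
    ContinuousOn x (Icc 0 T) := by
  simpa [uIcc_of_le h.time_nonneg] using h.arc_absolutelyContinuous.continuousOn

theorem IsFeasibleProcess.hasUnitDeviation (hv : Continuous v)
    (h : IsFeasibleProcess unitDisk v A B T x u) : HasUnitDeviation v T x := by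
  intro s t hs hst ht
  have hsub : Icc s t ⊆ Icc 0 T := Icc_subset_Icc hs ht
  refine norm_sub_sub_integral_le_of_ae_hasDerivAt (u := u) (w := fun r => v (x r)) hst
    (h.arc_absolutelyContinuous.mono ?_)
    (ae_restrict_of_ae_restrict_of_subset hsub h.dynamics)
    (fun r hr => mem_unitDisk_iff.1 (h.control_mem r (hsub hr)))
    (hv.comp_continuousOn (h.continuousOn.mono hsub))
  rwa [uIcc_of_le hst, uIcc_of_le h.time_nonneg]

theorem HasUnitDeviation.lipschitzOnWith {M : NNReal} (h : HasUnitDeviation v T x)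
    (hM : ∀ t ∈ Icc 0 T, ‖v (x t)‖ ≤ M) : LipschitzOnWith (1 + M) x (Icc 0 T) := by
  have key : ∀ s ∈ Icc 0 T, ∀ t ∈ Icc 0 T, s ≤ t → dist (x s) (x t) ≤ (1 + M : NNReal) * dist s t := by
    intro s hs t ht hst
    have h1 := h s t hs.1 hst ht.2
    have h2 : ‖∫ r in s..t, v (x r)‖ ≤ M * |t - s| := by
      refine intervalIntegral.norm_integral_le_of_norm_le_const fun r hr => hM r ?_
      rw [uIoc_of_le hst] at hr
      exact ⟨hs.1.trans hr.1.le, hr.2.trans ht.2⟩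
    rw [abs_of_nonneg (sub_nonneg.2 hst)] at h2
    rw [dist_comm (x s), dist_comm s, dist_eq_norm, Real.dist_eq, abs_of_nonneg (sub_nonneg.2 hst)]
    calc ‖x t - x s‖ = ‖(x t - x s - ∫ r in s..t, v (x r)) + ∫ r in s..t, v (x r)‖ := by
          rw [sub_add_cancel]
      _ ≤ (t - s) + M * (t - s) := (norm_add_le _ _).trans (add_le_add h1 h2)
      _ = _ := by push_cast; ring
  refine LipschitzOnWith.of_dist_le_mul fun s hs t ht => ?_
  rcases le_total s t with hst | hst
  · exact key s hs t ht hst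
  · rw [dist_comm (x s), dist_comm s]
    exact key t ht s hs hst

/-- Where an arc of unit deviation is differentiable, the control `x' - v(x)` is admissible. -/
theorem HasUnitDeviation.norm_deriv_sub_le (hv : Continuous v) (h : HasUnitDeviation v T x)
    (hx : ContinuousOn x (Icc 0 T)) {t : ℝ} (ht : t ∈ Ioo 0 T) (hd : DifferentiableAt ℝ x t) :
    ‖deriv x t - v (x t)‖ ≤ 1 := by
  have hw : ContinuousOn (fun r => v (x r)) (Icc 0 T) := hv.comp_continuousOn hx
  have hnhds : Icc 0 T ∈ 𝓝 t := Icc_mem_nhds ht.1 ht.2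
  have hint : HasDerivAt (fun s => ∫ r in t..s, v (x r)) (v (x t)) t := by
    refine intervalIntegral.integral_hasDerivAt_right (by simp) ?_ (hw.continuousAt hnhds)
    exact hw.stronglyMeasurableAtFilter_nhdsWithin measurableSet_Icc t
      |>.filter_mono (by rw [nhdsWithin_eq_nhds.2 hnhds])
  refine (hd.hasDerivAt.sub hint).le_of_lip' zero_le_one ?_
  filter_upwards [hnhds] with s hs
  rw [one_mul, Real.norm_eq_abs]
  rcases le_total t s with hts | hts
  · rw [abs_of_nonneg (sub_nonneg.2 hts)]
    refine le_of_eq_of_le (congrArg norm ?_) (h t s ht.1.le hts hs.2)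
    simp only [Pi.sub_apply, intervalIntegral.integral_same, sub_zero]
    abel
  · rw [abs_sub_comm, abs_of_nonneg (sub_nonneg.2 hts), norm_sub_rev]
    refine le_of_eq_of_le (congrArg norm ?_) (h s t hs.1 hts ht.2.le)
    simp only [Pi.sub_apply, intervalIntegral.integral_same, intervalIntegral.integral_symm s t]
    abel

/-- A Lipschitz arc of unit deviation from the flow is realized by a measurable control. -/
theorem HasUnitDeviation.exists_isFeasibleProcess (hv : Continuous v) {C : NNReal}
    (h : HasUnitDeviation v T x) (hT : 0 ≤ T) (hx : LipschitzOnWith C x (Icc 0 T))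
    (h0 : x 0 = A) (h1 : x T = B) (hS : ∀ t ∈ Icc 0 T, x t ∈ waterway) :
    ∃ u, IsFeasibleProcess unitDisk v A B T x u := by
  classical
  have hs : MeasurableSet {t | DifferentiableAt ℝ x t} := measurableSet_of_differentiableAt ℝ x
  have hae : ∀ᵐ t ∂volume.restrict (Icc 0 T), t ∈ Ioo 0 T ∧ DifferentiableAt ℝ x t := by
    rw [← restrict_Ioo_eq_restrict_Icc]
    filter_upwards [(hx.mono Ioo_subset_Icc_self).ae_differentiableWithinAt measurableSet_Ioo,
      ae_restrict_mem measurableSet_Ioo] with t ht htm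
    exact ⟨htm, ht.differentiableAt (isOpen_Ioo.mem_nhds htm)⟩
  refine ⟨({t | t ∈ Ioo 0 T ∧ DifferentiableAt ℝ x t} : Set ℝ).indicator
    fun t => deriv x t - v (x t), hT, ?_, ?_, ?_, ?_, h0, h1, hS⟩
  · refine AEMeasurable.indicator ?_ (measurableSet_Ioo.inter hs)
    exact (measurable_deriv x).aemeasurable.sub
      ((hv.comp_continuousOn hx.continuousOn).aemeasurable measurableSet_Icc)
  · intro t _
    rw [mem_unitDisk_iff]
    by_cases ht : t ∈ ({t | t ∈ Ioo 0 T ∧ DifferentiableAt ℝ x t} : Set ℝ)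
    · rw [indicator_of_mem ht]
      exact h.norm_deriv_sub_le hv hx.continuousOn ht.1 ht.2
    · rw [indicator_of_notMem ht]; simp
  · exact LipschitzOnWith.absolutelyContinuousOnInterval (K := C) (by rwa [uIcc_of_le hT])
  · filter_upwards [hae] with t ht
    rw [indicator_of_mem (by exact ht), sub_add_cancel]
    exact ht.2.hasDerivAt

end Feasible

/-! ### Equi-Lipschitz sequences of arcs -/

/-- The Arzelà–Ascoli theorem for equi-Lipschitz sequences of arcs in a compact set. -/
theorem exists_subseq_tendsto_of_lipschitzOnWith {E : Type*} [MetricSpace E] {a b : ℝ}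
    (hab : a ≤ b) {K : Set E} (hK : IsCompact K) {L : NNReal} {x : ℕ → ℝ → E}
    (hL : ∀ n, LipschitzOnWith L (x n) (Icc a b)) (hx : ∀ n, MapsTo (x n) (Icc a b) K) :
    ∃ (y : ℝ → E) (φ : ℕ → ℕ), StrictMono φ ∧ LipschitzOnWith L y (Icc a b) ∧
      ∀ t ∈ Icc a b, Tendsto (fun n => x (φ n) t) atTop (𝓝 (y t)) := by
  let f : ℕ → BoundedContinuousFunction (Icc a b) E := fun n =>
    BoundedContinuousFunction.mkOfCompact ⟨(Icc a b).domRestrict (x n), (hL n).continuousOn.domRestrict⟩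
  have hf : ∀ n t, f n t = x n t := fun n t => rfl
  have hcomp : IsCompact (closure (range f)) := by
    refine BoundedContinuousFunction.arzela_ascoli K hK (range f) ?_ ?_
    · rintro _ t ⟨n, rfl⟩
      exact hx n t.2
    · refine (LipschitzWith.uniformEquicontinuous _ L ?_).equicontinuous
      rintro ⟨_, n, rfl⟩
      exact (hL n).to_restrict
  obtain ⟨g, -, φ, hφ, hg⟩ := hcomp.tendsto_subseq (fun n => subset_closure (mem_range_self n))
  have hlim : ∀ t ∈ Icc a b, Tendsto (fun n => x (φ n) t) atTop (𝓝 (IccExtend hab g t)) := by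
    intro t ht
    rw [IccExtend_of_mem hab _ ht]
    exact ((BoundedContinuousFunction.tendsto_iff_tendstoUniformly.1 hg).tendsto_at ⟨t, ht⟩)
  refine ⟨IccExtend hab g, φ, hφ, LipschitzOnWith.of_dist_le_mul fun s hs t ht => ?_, hlim⟩
  exact le_of_tendsto' ((hlim s hs).dist (hlim t ht)) fun n => (hL (φ n)).dist_le_mul s hs t ht

/-! ### Confinement by the flow -/

section Confinement

variable {v : Plane → Plane} {A B : Plane} {T : ℝ} {x u : ℝ → Plane}

theorem isClosed_waterway : IsClosed waterway := by
  have h : Continuous fun x : Plane => x 0 := by fun_prop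
  exact (isClosed_le continuous_const h).inter (isClosed_le h continuous_const)

theorem HasUnitDeviation.abs_sub_sub_integral_le (hv : Continuous v) (h : HasUnitDeviation v T x)
    (hx : ContinuousOn x (Icc 0 T)) (i : Fin 2) {s t : ℝ} (hs : 0 ≤ s) (hst : s ≤ t) (ht : t ≤ T) :
    |x t i - x s i - ∫ r in s..t, v (x r) i| ≤ t - s := by
  have hint : IntervalIntegrable (fun r => v (x r)) volume s t := by
    refine (hv.comp_continuousOn (hx.mono ?_)).intervalIntegrable
    rw [uIcc_of_le hst]
    exact Icc_subset_Icc hs ht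
  have h1 : ∫ r in s..t, v (x r) i = (∫ r in s..t, v (x r)) i :=
    (EuclideanSpace.proj (𝕜 := ℝ) i).intervalIntegral_comp_comm hint
  rw [h1]
  exact (PiLp.norm_apply_le (x t - x s - ∫ r in s..t, v (x r)) i).trans (h s t hs hst ht)

/-- The flow drives the arc from `A` to `B`, so that it can neither retreat from `A` nor overshoot
`B` by more than what the control achieves against the flow in the available time. -/
theorem HasUnitDeviation.abs_apply_one_le (hv : Continuous v) (h : HasUnitDeviation v T x)
    (hx : ContinuousOn x (Icc 0 T)) (h0 : x 0 = A) (h1 : x T = B)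
    (hS : ∀ t ∈ Icc 0 T, x t ∈ waterway) (hflow : FlowsFromTo v A B) {t : ℝ} (ht : t ∈ Icc 0 T) :
    |x t 1| ≤ |A 1| + |B 1| + T := by
  have hA := abs_le.1 (h.abs_sub_sub_integral_le hv hx 1 le_rfl ht.1 ht.2)
  have hB := abs_le.1 (h.abs_sub_sub_integral_le hv hx 1 ht.1 ht.2 le_rfl)
  have hS1 : ∀ r ∈ Icc 0 t, x r ∈ waterway := fun r hr => hS r ⟨hr.1, hr.2.trans ht.2⟩
  have hS2 : ∀ r ∈ Icc t T, x r ∈ waterway := fun r hr => hS r ⟨ht.1.trans hr.1, hr.2⟩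
  rw [h0] at hA
  rw [h1] at hB
  have ht1 := ht.1
  have ht2 := ht.2
  have := abs_nonneg (A 1)
  have := abs_nonneg (B 1)
  have := le_abs_self (A 1)
  have := le_abs_self (B 1)
  have := neg_abs_le (A 1)
  have := neg_abs_le (B 1)
  rcases hflow with ⟨-, hf⟩ | ⟨-, hf⟩
  · have i1 : 0 ≤ ∫ r in 0..t, v (x r) 1 :=
      intervalIntegral.integral_nonneg ht.1 fun r hr => hf _ (hS1 r hr)
    have i2 : 0 ≤ ∫ r in t..T, v (x r) 1 :=
      intervalIntegral.integral_nonneg ht.2 fun r hr => hf _ (hS2 r hr)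
    exact abs_le.2 ⟨by linarith, by linarith⟩
  · have i1 : ∫ r in 0..t, v (x r) 1 ≤ 0 :=
      neg_nonneg.1 <| intervalIntegral.integral_neg (f := fun r => v (x r) 1) ▸
        intervalIntegral.integral_nonneg ht.1 fun r hr => neg_nonneg.2 (hf _ (hS1 r hr))
    have i2 : ∫ r in t..T, v (x r) 1 ≤ 0 :=
      neg_nonneg.1 <| intervalIntegral.integral_neg (f := fun r => v (x r) 1) ▸
        intervalIntegral.integral_nonneg ht.2 fun r hr => neg_nonneg.2 (hf _ (hS2 r hr))
    exact abs_le.2 ⟨by linarith, by linarith⟩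

theorem norm_le_of_mem_waterway {y : Plane} {c : ℝ} (hy : y ∈ waterway) (hc : |y 1| ≤ c) :
    ‖y‖ ≤ 1 + c := by
  have hc0 : 0 ≤ c := (abs_nonneg _).trans hc
  rw [EuclideanSpace.norm_eq, Fin.sum_univ_two]
  refine Real.sqrt_le_iff.2 ⟨by positivity, ?_⟩
  have h0 : ‖y 0‖ ≤ 1 := abs_le.2 hy
  have h1 : ‖y 1‖ ≤ c := hc
  have : ‖y 0‖ ^ 2 ≤ 1 ^ 2 := by gcongr
  have : ‖y 1‖ ^ 2 ≤ c ^ 2 := by gcongr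
  nlinarith

end Confinement

/-! ### Existence of an optimal process -/

theorem hasUnitDeviation_of_tendsto {v : Plane → Plane} (hv : Continuous v) {T M : ℝ}
    {x : ℕ → ℝ → Plane} {y : ℝ → Plane} (h : ∀ n, HasUnitDeviation v T (x n))
    (hx : ∀ n, ContinuousOn (x n) (Icc 0 T)) (hM : ∀ n, ∀ t ∈ Icc 0 T, ‖v (x n t)‖ ≤ M)
    (hlim : ∀ t ∈ Icc 0 T, Tendsto (fun n => x n t) atTop (𝓝 (y t))) :
    HasUnitDeviation v T y := by
  intro s t hs hst ht
  have hsub : uIoc s t ⊆ Icc 0 T := by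
    rw [uIoc_of_le hst]
    exact fun r hr => ⟨hs.trans hr.1.le, hr.2.trans ht⟩
  have hint : Tendsto (fun n => ∫ r in s..t, v (x n r)) atTop (𝓝 (∫ r in s..t, v (y r))) := by
    refine intervalIntegral.tendsto_integral_filter_of_dominated_convergence (fun _ => M)
      (Eventually.of_forall fun n => ?_) (Eventually.of_forall fun n => ?_)
      intervalIntegrable_const ?_
    · exact (hv.comp_continuousOn ((hx n).mono hsub)).aestronglyMeasurable measurableSet_uIoc
    · exact Eventually.of_forall fun r hr => hM n r (hsub hr)
    · exact Eventually.of_forall fun r hr => (hv.tendsto _).comp (hlim r (hsub hr))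
  exact le_of_tendsto' (((hlim t ⟨hs.trans hst, ht⟩).sub (hlim s ⟨hs, hst.trans ht⟩)).sub hint).norm
    fun n => h n s t hs hst ht

theorem exists_isTimeOptimal {v : Plane → Plane} (hv : Continuous v) {A B : Plane}
    (hflow : FlowsFromTo v A B)
    (hne : ∃ (T : ℝ) (x u : ℝ → Plane), IsFeasibleProcess unitDisk v A B T x u) :
    ∃ (T : ℝ) (x u : ℝ → Plane), IsTimeOptimal unitDisk v A B T x u := by
  let S : Set ℝ := {T | ∃ x u : ℝ → Plane, IsFeasibleProcess unitDisk v A B T x u}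
  have hbdd : BddBelow S := ⟨0, fun T ⟨_, _, h⟩ => h.time_nonneg⟩
  obtain ⟨T, hTanti, hTlim, hTS⟩ := exists_seq_tendsto_sInf (S := S) hne hbdd
  set τ := sInf S
  choose x u hxu using hTS
  have hτT : ∀ n, τ ≤ T n := fun n => csInf_le hbdd ⟨_, _, hxu n⟩
  have hτ : 0 ≤ τ := le_csInf hne fun T ⟨_, _, h⟩ => h.time_nonneg
  have hdev : ∀ n, HasUnitDeviation v (T n) (x n) := fun n => (hxu n).hasUnitDeviation hv
  -- By the confinement estimate, all the arcs stay in the ball `K`, on which `v` is bounded.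
  let K : Set Plane := Metric.closedBall 0 (1 + (|A 1| + |B 1| + T 0))
  have hK : IsCompact K := isCompact_closedBall _ _
  have hxK : ∀ n, ∀ t ∈ Icc 0 (T n), x n t ∈ K := fun n t ht => by
    rw [mem_closedBall_zero_iff]
    refine norm_le_of_mem_waterway ((hxu n).state_mem t ht) ?_
    have := (hdev n).abs_apply_one_le hv (hxu n).continuousOn (hxu n).initial (hxu n).terminal
      (hxu n).state_mem hflow ht
    linarith [hTanti (Nat.zero_le n)]
  obtain ⟨M₀, hM₀⟩ := hK.exists_bound_of_continuousOn hv.continuousOn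
  have hvM : ∀ n, ∀ t ∈ Icc 0 (T n), ‖v (x n t)‖ ≤ M₀.toNNReal := fun n t ht =>
    (hM₀ _ (hxK n t ht)).trans (Real.le_coe_toNNReal _)
  have hLip : ∀ n, LipschitzOnWith (1 + M₀.toNNReal) (x n) (Icc 0 (T n)) := fun n =>
    (hdev n).lipschitzOnWith (hvM n)
  have hsub : ∀ n, Icc 0 τ ⊆ Icc 0 (T n) := fun n => Icc_subset_Icc_right (hτT n)
  have hLip' := fun n => (hLip n).mono (hsub n)
  obtain ⟨y, φ, hφ, hyL, hlim⟩ := exists_subseq_tendsto_of_lipschitzOnWith hτ hK hLip'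
    fun n t ht => hxK n t (hsub n ht)
  have hydev : HasUnitDeviation v τ y := hasUnitDeviation_of_tendsto hv (x := fun n => x (φ n))
    (fun n s t hs hst ht => hdev (φ n) s t hs hst (ht.trans (hτT _)))
    (fun n => (hLip' (φ n)).continuousOn) (fun n t ht => hvM (φ n) t (hsub _ ht)) hlim
  have hy0 : y 0 = A := tendsto_nhds_unique (hlim 0 ⟨le_rfl, hτ⟩)
    (by simp only [(hxu _).initial]; exact tendsto_const_nhds)
  -- `x n τ` differs from `x n (T n) = B` by at most a multiple of `T n - τ`.
  have hyτ : y τ = B := by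
    refine tendsto_nhds_unique (hlim τ ⟨hτ, le_rfl⟩) (tendsto_iff_dist_tendsto_zero.2 ?_)
    have h0 : Tendsto (fun n => ((1 + M₀.toNNReal : NNReal) : ℝ) * dist τ (T (φ n))) atTop (𝓝 0) := by
      have := (tendsto_const_nhds (x := τ)).dist (hTlim.comp hφ.tendsto_atTop)
      simpa using this.const_mul ((1 + M₀.toNNReal : NNReal) : ℝ)
    refine squeeze_zero (fun n => dist_nonneg) (fun n => ?_) h0
    rw [← (hxu (φ n)).terminal]
    exact (hLip (φ n)).dist_le_mul _ ⟨hτ, hτT _⟩ _ ⟨hτ.trans (hτT _), le_rfl⟩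
  obtain ⟨w, hw⟩ := hydev.exists_isFeasibleProcess hv hτ hyL hy0 hyτ fun t ht =>
    isClosed_waterway.mem_of_tendsto (hlim t ht)
      (Eventually.of_forall fun n => (hxu (φ n)).state_mem t (hsub _ ht))
  exact ⟨τ, y, w, hw, fun T' x' u' h' => csInf_le hbdd ⟨x', u', h'⟩⟩

/-! ### Feasibility along the axis -/

/-- The scalar equation `φ' = g(φ)` with `g > 0` has a solution from `a` to `b ≥ a`: the inverse
of the travel time `y ↦ ∫ₐʸ 1 / g`. -/
theorem exists_hasDerivAt_comp_of_pos {g : ℝ → ℝ} (hg : Continuous g) (hpos : ∀ y, 0 < g y)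
    {a b : ℝ} (hab : a ≤ b) :
    ∃ (T : ℝ) (φ : ℝ → ℝ), 0 ≤ T ∧ φ 0 = a ∧ φ T = b ∧
      ∀ t ∈ Icc 0 T, HasDerivAt φ (g (φ t)) t := by
  have hcont : Continuous fun y => (g y)⁻¹ := hg.inv₀ fun y => (hpos y).ne'
  let F : ℝ → ℝ := fun y => ∫ s in a..y, (g s)⁻¹
  have hF : ∀ y, HasStrictDerivAt F (g y)⁻¹ y := hcont.integral_hasStrictDerivAt a
  have hmono : StrictMono F := strictMono_of_deriv_pos fun y => by
    rw [(hF y).hasDerivAt.deriv]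
    exact inv_pos.2 (hpos y)
  have hinv : ∀ y, Function.invFun F (F y) = y := Function.leftInverse_invFun hmono.injective
  have hFa : F a = 0 := intervalIntegral.integral_same
  refine ⟨F b, Function.invFun F, hFa ▸ hmono.monotone hab, ?_, hinv b, fun t ht => ?_⟩
  · rw [← hFa, hinv]
  · have hFc : ContinuousOn F (Icc a b) := fun y _ => (hF y).hasDerivAt.continuousAt.continuousWithinAt
    obtain ⟨y, -, rfl⟩ := intermediate_value_Icc hab hFc (by rwa [hFa])
    rw [hinv]
    simpa using ((hF y).to_local_left_inverse (inv_pos.2 (hpos y)).ne'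
      (Eventually.of_forall hinv)).hasDerivAt

/-- A control whose first component cancels that of the flow keeps the arc on a line parallel to
the axis, and leaves `√(1 - v₁²)` for the motion along it, in the direction `σ = ±1`. -/
theorem exists_isFeasibleProcess_of_hasDerivAt {v : Plane → Plane} (hv : Continuous v)
    (hv1 : ∀ x : Plane, |v x 0| < 1) {A B : Plane} (hA : A ∈ waterway) (hAB : A 0 = B 0)
    {σ : ℝ} (hσ : σ ^ 2 = 1) {T : ℝ} {φ : ℝ → ℝ} (hT : 0 ≤ T) (h0 : φ 0 = A 1) (h1 : φ T = B 1)
    (hφ : ∀ t ∈ Icc 0 T, HasDerivAt φ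
      (σ * √(1 - v !₂[A 0, φ t] 0 ^ 2) + v !₂[A 0, φ t] 1) t) :
    ∃ x u, IsFeasibleProcess unitDisk v A B T x u := by
  let x : ℝ → Plane := fun t => !₂[A 0, φ t]
  let u : ℝ → Plane := fun t => !₂[-v (x t) 0, σ * √(1 - v (x t) 0 ^ 2)]
  have hφc : ContinuousOn φ (Icc 0 T) := fun t ht => (hφ t ht).continuousAt.continuousWithinAt
  have hxc : ContinuousOn x (Icc 0 T) := by
    refine (PiLp.continuous_toLp 2 _).comp_continuousOn (continuousOn_pi.2 fun i => ?_)
    fin_cases i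
    · exact continuousOn_const
    · exact hφc
  have hvc : ∀ i, Continuous fun y => v y i := fun i => by fun_prop
  have huc : ContinuousOn u (Icc 0 T) := by
    refine Continuous.comp_continuousOn
      (g := fun y : Plane => (!₂[-v y 0, σ * √(1 - v y 0 ^ 2)] : Plane)) ?_ hxc
    refine (PiLp.continuous_toLp 2 _).comp (continuous_pi fun i => ?_)
    have := hvc 0
    fin_cases i
    · exact this.neg
    · exact continuous_const.mul (continuous_const.sub (this.pow 2)).sqrt
  have hx : ∀ t ∈ Icc 0 T, HasDerivAt x (u t + v (x t)) t := fun t ht => by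
    refine (PiLp.continuousLinearEquiv 2 ℝ fun _ : Fin 2 => ℝ).symm.hasFDerivAt.comp_hasDerivAt
      (f := fun t => ![A 0, φ t]) (f' := (u t + v (x t)).ofLp) t (hasDerivAt_pi.2 fun i => ?_)
    fin_cases i
    · simpa [x, u] using hasDerivAt_const t (A 0)
    · simpa [x, u] using hφ t ht
  obtain ⟨C, hC⟩ := isCompact_Icc.exists_bound_of_continuousOn
    (huc.add (hv.comp_continuousOn hxc))
  have hLip : LipschitzOnWith C.toNNReal x (uIcc 0 T) := by
    rw [uIcc_of_le hT]
    exact (convex_Icc 0 T).lipschitzOnWith_of_nnnorm_hasDerivWithin_le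
      (fun t ht => (hx t ht).hasDerivWithinAt)
      fun t ht => NNReal.coe_le_coe.1 ((hC t ht).trans (Real.le_coe_toNNReal C))
  refine ⟨x, u, hT, huc.aemeasurable measurableSet_Icc, fun t _ => ?_,
    hLip.absolutelyContinuousOnInterval, ?_, ?_, ?_, fun t _ => by simpa [x, waterway] using hA⟩
  · have : 0 ≤ 1 - v (x t) 0 ^ 2 := sub_nonneg.2 ((sq_le_one_iff_abs_le_one _).2 (hv1 _).le)
    simp [u, unitDisk, mul_pow, hσ, Real.sq_sqrt this]
  · filter_upwards [ae_restrict_mem measurableSet_Icc] with t ht using hx t ht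
  · ext i; fin_cases i <;> simp [x, h0]
  · ext i; fin_cases i <;> simp [x, h1, hAB]

theorem exists_isFeasibleProcess_of_apply_zero_eq {v : Plane → Plane} (hv : Continuous v)
    (hv1 : ∀ x : Plane, |v x 0| < 1) {A B : Plane} (hA : A ∈ waterway)
    (hflow : FlowsFromTo v A B) (hAB : A 0 = B 0) :
    ∃ (T : ℝ) (x u : ℝ → Plane), IsFeasibleProcess unitDisk v A B T x u := by
  have hline : Continuous fun y : ℝ => v !₂[A 0, y] := by
    refine hv.comp ((PiLp.continuous_toLp 2 _).comp (continuous_pi fun i => ?_))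
    fin_cases i
    · exact continuous_const
    · exact continuous_id
  have hmem : ∀ y : ℝ, !₂[A 0, y] ∈ waterway := fun y => by simpa [waterway] using hA
  have hw : ∀ y : ℝ, 0 < √(1 - v !₂[A 0, y] 0 ^ 2) := fun y =>
    Real.sqrt_pos.2 (sub_pos.2 ((sq_lt_one_iff_abs_lt_one _).2 (hv1 _)))
  rcases hflow with ⟨hle, hf⟩ | ⟨hle, hf⟩
  · obtain ⟨T, φ, hT, h0, h1, hφ⟩ := exists_hasDerivAt_comp_of_pos
      (g := fun y => 1 * √(1 - v !₂[A 0, y] 0 ^ 2) + v !₂[A 0, y] 1) (by fun_prop)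
      (fun y => by linarith [hw y, hf _ (hmem y)]) hle
    exact ⟨T, exists_isFeasibleProcess_of_hasDerivAt hv hv1 hA hAB (one_pow 2) hT h0 h1 hφ⟩
  · -- The downward motion is the reflection `y ↦ -y` of an upward one.
    obtain ⟨T, φ, hT, h0, h1, hφ⟩ := exists_hasDerivAt_comp_of_pos
      (g := fun y => -(-1 * √(1 - v !₂[A 0, -y] 0 ^ 2) + v !₂[A 0, -y] 1)) (by fun_prop)
      (fun y => by linarith [hw (-y), hf _ (hmem (-y))]) (neg_le_neg hle)
    refine ⟨T, exists_isFeasibleProcess_of_hasDerivAt hv hv1 hA hAB (σ := -1) (by norm_num) hT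
      (φ := fun t => -φ t) (by simp [h0]) (by simp [h1]) fun t ht => ?_⟩
    simpa using (hφ t ht).fun_neg

theorem claim2 (v : Plane → Plane) (hv : ContDiff ℝ 1 v)
    (hv1 : ∀ x : Plane, |v x 0| < 1)
    (A B : Plane) (hA : A ∈ waterway) (hB : B ∈ waterway)
    (hflow : FlowsFromTo v A B) :
    (A 0 = B 0 →
      ∃ (T : ℝ) (x u : ℝ → Plane), IsFeasibleProcess unitDisk v A B T x u) ∧
    ((∃ (T : ℝ) (x u : ℝ → Plane), IsFeasibleProcess unitDisk v A B T x u) →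
      ∃ (T : ℝ) (x u : ℝ → Plane), IsTimeOptimal unitDisk v A B T x u) := by
  exact ⟨exists_isFeasibleProcess_of_apply_zero_eq hv.continuous hv1 hA hflow,
    exists_isTimeOptimal hv.continuous hflow⟩
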